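/- Let $p$ be a known probability mass function on $\mathbb{Z}$, let $\mathbb{H}=\ell^2(\mathbb{Z})$ (real sequences), and let $\mathbb{H}_1$ be the set of probability mass functions on $\mathbb{Z}$, regarded as elements of $\mathbb{H}$. For $f\in\mathbb{H}_1$ put $\pi_f(x)=\sum_{\theta\in\mathbb{Z}}p(x-\theta)f(\theta)$, and let $\mathbb{E}_f$ denote expectation when $X_1,\dots,X_n$ are i.i.d. with probability mass function $\pi_f$. Let $\mathcal{S}_n$ be the set of measurable maps $\hat f:\mathbb{Z}^n\to\mathbb{H}$ (estimators); the MISE of $\hat f$ at $f$ is $\mathbb{E}_f\|\hat f-f\|_{\mathbb{H}}^2\in[0,\infty]$. Put $p^*(\lambda)=\sum_{k}p(k)e^{-ik\lambda}$, and let $P_n^*(\lambda)=\sum_k P_n\mathbf{1}_k\,e^{-ik\lambda}$, where $P_n\mathbf{1}_k=n^{-1}\#\{i:X_i=k\}$. Assume that $$K_p:=\int_{-\pi}^{\pi}\frac{d\lambda}{|p^*(\lambda)|^2}<\infty .$$ For $n\ge1$ let $\hat f_{\infty,n}$ be the estimator with Fourier series $P_n^*/p^*$, that is, $$\hat f_{\infty,n}(k)=\frac1{2\pi}\int_{-\pi}^{\pi}\frac{P_n^*(\lambda)}{p^*(\lambda)}e^{ik\lambda}\,d\lambda\qquad(k\in\mathbb{Z}).$$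 Then $\hat f_{\infty,n}$ is real-valued, belongs to $\mathcal{S}_n$ and is unbiased: $\mathbb{E}_f\hat f_{\infty,n}(k)=f(k)$ for all $f\in\mathbb{H}_1$ and $k\in\mathbb{Z}$. Its maximal MISE over $\mathbb{H}_1$ has rate $n^{-1}$ (it lies between $a/n$ and $K_p/(2\pi n)$ for all $n\ge1$, for some $a>0$ independent of $n$). This rate is minimax, and attained by $\hat f_{\infty,n}$, over any class $\mathcal{C}\subseteq\mathbb{H}_1$ that contains a line segment $[f_0,f_1]=\{(1-w)f_0+wf_1:w\in[0,1]\}$ with distinct $f_0,f_1\in\mathbb{H}_1$: there is $a>0$ such that for all $n\ge1$ $$\frac an\le\inf_{\hat f\in\mathcal{S}_n}\sup_{f\in\mathcal{C}}\mathbb{E}_f\|\hat f-f\|_{\mathbb{H}}^2\le\sup_{f\in\mathcal{C}}\mathbb{E}_f\|\hat f_{\infty,n}-f\|_{\mathbb{H}}^2\le\frac{K_p}{2\pi n}.$$ More precisely, there are universal constants $K_1,K_2>0$ (independent of $p$, $f_0$, $f_1$ and $n$) such that for all $f_0,f_1\in\mathbb{H}_1$ and all $n\ge1$ $$c_0(K_1+K_2c_1n)^{-1}\le\inf_{\hat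 f\in\mathcal{S}_n}\sup_{f\in[f_0,f_1]}\mathbb{E}_f\|\hat f-f\|_{\mathbb{H}}^2\le\sup_{f\in\mathbb{H}_1}\mathbb{E}_f\|\hat f_{\infty,n}-f\|_{\mathbb{H}}^2\le\frac{K_p}{2\pi n},$$ where $c_0=\sum_{l\in\mathbb{Z}}(f_1(l)-f_0(l))^2$ and $c_1=\sum_{l\in\mathbb{Z}}|\pi_{f_1}(l)-\pi_{f_0}(l)|$. -/

import Mathlib

open scoped ENNReal

noncomputable section

namespace DiscreteDeconvolution

/-- The Hilbert space `l²(ℤ)` of real square-summable sequences (the `L²` space of counting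
measure on `ℤ`). -/
abbrev H : Type := lp (fun _ : ℤ => ℝ) 2

/-- The probability densities (with respect to counting measure on `ℤ`) that lie in `l²(ℤ)`. -/
def H₁ : Set H := {f | (∀ k : ℤ, 0 ≤ f k) ∧ HasSum (fun k : ℤ => f k) 1}

/-- The mixture density `π_f (x) = ∑_θ p (x - θ) f (θ)`, i.e. the convolution of `f` and `p`. -/
def mixDensity (p : PMF ℤ) (f : H) (x : ℤ) : ℝ := ∑' θ : ℤ, (p (x - θ)).toReal * f θ

/-- The law on `ℤ` with density `π_f` with respect to counting measure. -/
def mixLaw (p : PMF ℤ) (f : H) : MeasureTheory.Measure ℤ :=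
  MeasureTheory.Measure.count.withDensity fun x => ENNReal.ofReal (mixDensity p f x)

/-- The law of `n` i.i.d. observations from `π_f`. -/
def sampleLaw (p : PMF ℤ) (f : H) (n : ℕ) : MeasureTheory.Measure (Fin n → ℤ) :=
  MeasureTheory.Measure.pi fun _ => mixLaw p f

/-- The estimators from `n` observations: measurable maps from `ℤⁿ` to `l²(ℤ)`, where `l²(ℤ)`
carries its Borel σ-algebra. -/
def estimators (n : ℕ) : Set ((Fin n → ℤ) → H) :=
  {g | @Measurable (Fin n → ℤ) H MeasurableSpace.pi (borel H) g}

/-- The mean integrated squared error `E_f ‖g - f‖²` of the estimator `g`, possibly infinite. -/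
def mise (p : PMF ℤ) {n : ℕ} (g : (Fin n → ℤ) → H) (f : H) : ℝ≥0∞ :=
  ∫⁻ x, ENNReal.ofReal (‖g x - f‖ ^ 2) ∂(sampleLaw p f n)

/-- The largest mean integrated squared error of `g` over the class `C`. -/
def maxMise (p : PMF ℤ) {n : ℕ} (g : (Fin n → ℤ) → H) (C : Set H) : ℝ≥0∞ :=
  ⨆ f ∈ C, mise p g f

/-- The minimax mean integrated squared error over the class `C` from `n` observations. -/
def minimaxMise (p : PMF ℤ) (n : ℕ) (C : Set H) : ℝ≥0∞ :=
  ⨅ g ∈ estimators n, maxMise p g C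

/-- The Fourier series `a* (t) = ∑_k a(k) e^{-ikt}` with coefficients `a`. -/
def fourierSeries (a : ℤ → ℝ) (t : ℝ) : ℂ :=
  ∑' k : ℤ, (a k : ℂ) * Complex.exp (-(Complex.I * k * t))

/-- The Fourier series `p*` of the error distribution. -/
def pStar (p : PMF ℤ) : ℝ → ℂ := fourierSeries fun k => (p k).toReal

/-- `K_p = ∫_{-π}^{π} |p*(t)|⁻² dt` in `[0, ∞]`; the integrand is `∞` where `p*` vanishes. -/
def Kp (p : PMF ℤ) : ℝ≥0∞ :=
  ∫⁻ t in Set.Ioc (-Real.pi) Real.pi, (‖pStar p t‖ₑ ^ 2)⁻¹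

/-- The empirical frequencies `P_n 1_k` of the sample `x`. -/
def empirical {n : ℕ} (x : Fin n → ℤ) (k : ℤ) : ℝ :=
  (1 / (n : ℝ)) * ∑ i : Fin n, if x i = k then 1 else 0

/-- The `k`-th Fourier coefficient `(2π)⁻¹ ∫_{-π}^{π} (P_n*(t) / p*(t)) e^{ikt} dt` of
`P_n* / p*`. -/
def fourierCoefficient (p : PMF ℤ) {n : ℕ} (x : Fin n → ℤ) (k : ℤ) : ℂ :=
  (1 / (2 * Real.pi) : ℂ) * ∫ t in (-Real.pi)..Real.pi,
    fourierSeries (empirical x) t / pStar p t * Complex.exp (Complex.I * k * t)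

open Classical in
/-- The Fourier estimator: the element of `l²(ℤ)` whose coordinates are the Fourier coefficients
of `P_n* / p*`. The default value `0` is used only if these coefficients are not the coordinates
of an element of the real space `l²(ℤ)`. -/
def fourierEstimator (p : PMF ℤ) (n : ℕ) (x : Fin n → ℤ) : H :=
  if h : ∃ g : H, ∀ k : ℤ, ((g k : ℝ) : ℂ) = fourierCoefficient p x k then h.choose else 0

end DiscreteDeconvolution

end

noncomputable section

namespace DiscreteDeconvolution

open MeasureTheory

/-! Lower bound. Take two points of the segment placed symmetrically about its midpoint at offset
`h`. If the Hellinger affinity of their sample laws is at least 1/2, Cauchy–Schwarz prevents any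
estimator from being close to both (`enorm_sub_sq_mul_le_of_singleton_le`). Around the midpoint the
one-observation affinity loses only `2 * h ^ 2 * c₁` (`half_add_sub_le_sqrt`); affinities multiply
over independent observations, so Bernoulli's inequality allows `h ^ 2` of order `1 / (1 + c₁ n)`.

Upper bound. Let `kernel` be the sequence with Fourier series `1 / p*`. The estimator is the average
of the translates `kernel (k - X i)`. Convolving the kernel with `p` gives the unit mass at 0
(`tsum_kernel_sub_mul`), whence unbiasedness. The risk is then a sum of coordinate variances, each
at most `1 / n` times a second moment of the kernel; translation invariance and Parseval
(`exists_hasSum_sq_kernel`) bound the total by `Kp p / (2πn)`. -/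

/-! ### Affinity and the two-point method -/

/-- Cauchy–Schwarz for counting measure, with factors `u √μ` and `√ν`. Domination on atoms is all
that is needed of `η`, which plays the role of the affinity measure `√(μν)`. -/
theorem lintegral_sq_le_of_singleton_le {α : Type*} [MeasurableSpace α] [Countable α]
    [MeasurableSingletonClass α] {η μ ν : Measure α}
    (h : ∀ x, η {x} ≤ μ {x} ^ (1 / 2 : ℝ) * ν {x} ^ (1 / 2 : ℝ)) (u : α → ℝ≥0∞) :
    ∫⁻ x, u x ∂η ≤ (∫⁻ x, u x ^ 2 ∂μ) ^ (1 / 2 : ℝ) * ν Set.univ ^ (1 / 2 : ℝ) := by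
  have key := ENNReal.lintegral_mul_le_Lp_mul_Lq (Measure.count : Measure α)
    Real.HolderConjugate.two_two
    (f := fun x => u x * μ {x} ^ (1 / 2 : ℝ)) (g := fun x => ν {x} ^ (1 / 2 : ℝ))
    (Measurable.of_discrete.aemeasurable) (Measurable.of_discrete.aemeasurable)
  have hν : ∑' x, ν {x} = ν Set.univ := by
    simpa using (lintegral_countable' (μ := ν) (fun _ => (1 : ℝ≥0∞))).symm
  have hsq : ∀ y : ℝ≥0∞, (y ^ (1 / 2 : ℝ)) ^ (2 : ℝ) = y := fun y => by
    rw [← ENNReal.rpow_mul]; norm_num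
  simp only [lintegral_count, ENNReal.mul_rpow_of_nonneg _ _ (zero_le_two : (0 : ℝ) ≤ 2), hsq,
    hν] at key
  simp only [lintegral_countable']
  refine le_trans (ENNReal.tsum_le_tsum fun x => ?_) (key.trans_eq ?_)
  · simp only [Pi.mul_apply, mul_assoc]
    gcongr
    exact h x
  · simp

/-- Integrate the triangle inequality through `g x` against `η`; Cauchy–Schwarz then charges each
distance to the law under which it is controlled. -/
theorem enorm_sub_sq_mul_le_of_singleton_le {α E : Type*} [MeasurableSpace α] [Countable α]
    [MeasurableSingletonClass α] [NormedAddCommGroup E] {η μ ν : Measure α}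
    [IsProbabilityMeasure μ] [IsProbabilityMeasure ν]
    (h : ∀ x, η {x} ≤ μ {x} ^ (1 / 2 : ℝ) * ν {x} ^ (1 / 2 : ℝ)) (g : α → E) (a b : E)
    {R : ℝ≥0∞} (hμ : ∫⁻ x, ‖g x - a‖ₑ ^ 2 ∂μ ≤ R) (hν : ∫⁻ x, ‖g x - b‖ₑ ^ 2 ∂ν ≤ R) :
    (‖a - b‖ₑ * η Set.univ) ^ 2 ≤ 4 * R := by
  have h₁ := lintegral_sq_le_of_singleton_le h (fun x => ‖g x - a‖ₑ)
  have h₂ := lintegral_sq_le_of_singleton_le (μ := ν) (ν := μ)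
    (fun x => (h x).trans_eq (mul_comm _ _)) (fun x => ‖g x - b‖ₑ)
  simp only [measure_univ, ENNReal.one_rpow, mul_one] at h₁ h₂
  have h₃ : ‖a - b‖ₑ * η Set.univ ≤ 2 * R ^ (1 / 2 : ℝ) := by
    calc ‖a - b‖ₑ * η Set.univ = ∫⁻ _, ‖a - b‖ₑ ∂η := by simp
      _ ≤ ∫⁻ x, (‖g x - a‖ₑ + ‖g x - b‖ₑ) ∂η := by
          refine lintegral_mono fun x => ?_
          simp only [← edist_eq_enorm_sub]
          exact edist_triangle_left _ _ _
      _ = ∫⁻ x, ‖g x - a‖ₑ ∂η + ∫⁻ x, ‖g x - b‖ₑ ∂η :=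
          lintegral_add_left Measurable.of_discrete _
      _ ≤ R ^ (1 / 2 : ℝ) + R ^ (1 / 2 : ℝ) := by
          refine add_le_add (h₁.trans ?_) (h₂.trans ?_) <;> gcongr
      _ = _ := (two_mul _).symm
  calc _ ≤ (2 * R ^ (1 / 2 : ℝ)) ^ 2 := by gcongr
    _ = 4 * R := by
      rw [mul_pow, ← ENNReal.rpow_natCast (R ^ _), ← ENNReal.rpow_mul]
      norm_num

theorem pi_singleton_le_of_singleton_le {ι α : Type*} [Fintype ι] [MeasurableSpace α]
    {η μ ν : Measure α} [SigmaFinite η] [SigmaFinite μ] [SigmaFinite ν]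
    (h : ∀ x, η {x} ≤ μ {x} ^ (1 / 2 : ℝ) * ν {x} ^ (1 / 2 : ℝ)) (x : ι → α) :
    Measure.pi (fun _ => η) {x} ≤
      Measure.pi (fun _ => μ) {x} ^ (1 / 2 : ℝ) * Measure.pi (fun _ => ν) {x} ^ (1 / 2 : ℝ) := by
  rw [Measure.pi_singleton, Measure.pi_singleton, Measure.pi_singleton,
    ← ENNReal.prod_rpow_of_nonneg (by norm_num), ← ENNReal.prod_rpow_of_nonneg (by norm_num),
    ← Finset.prod_mul_distrib]
  exact Finset.prod_le_prod' fun i _ => h _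

/-- The product under the root is `((a + b) / 2) ^ 2 - h ^ 2 * (b - a) ^ 2`, by symmetry about the
midpoint. The loss is therefore quadratic in `h`, even where `a` or `b` vanishes, and `|b - a| ≤ a +
b` makes it linear in `|b - a|`. -/
theorem half_add_sub_le_sqrt {a b h : ℝ} (ha : 0 ≤ a) (hb : 0 ≤ b) (hh : h ^ 2 ≤ 1 / 4) :
    (a + b) / 2 - 2 * h ^ 2 * |b - a| ≤
      √(((1 / 2 + h) * a + (1 / 2 - h) * b) * ((1 / 2 - h) * a + (1 / 2 + h) * b)) := by
  apply Real.le_sqrt_of_sq_le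
  have h₁ : |b - a| ≤ a + b := abs_sub_le_iff.2 ⟨by linarith, by linarith⟩
  have h₂ : (b - a) ^ 2 = |b - a| ^ 2 := (sq_abs _).symm
  have h₃ := abs_nonneg (b - a)
  have e : ((1 / 2 + h) * a + (1 / 2 - h) * b) * ((1 / 2 - h) * a + (1 / 2 + h) * b) =
      ((a + b) / 2) ^ 2 - h ^ 2 * (b - a) ^ 2 := by ring
  rw [e, h₂]
  generalize |b - a| = d at *
  have h₄ : 0 ≤ h ^ 2 * d * ((a + b) - d) :=
    mul_nonneg (mul_nonneg (sq_nonneg h) h₃) (by linarith)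
  have h₅ : 0 ≤ h ^ 2 * d ^ 2 * (1 / 4 - h ^ 2) :=
    mul_nonneg (mul_nonneg (sq_nonneg h) (sq_nonneg d)) (by linarith)
  nlinarith

/-! ### Mixture densities -/

theorem hasSum_toReal_pmf {α : Type*} (p : PMF α) : HasSum (fun k => (p k).toReal) 1 := by
  have h := ENNReal.hasSum_toReal (f := p) (by rw [p.tsum_coe]; exact ENNReal.one_ne_top)
  rwa [← ENNReal.tsum_toReal_eq p.apply_ne_top, p.tsum_coe, ENNReal.toReal_one] at h

theorem ofReal_tsum_le {α : Type*} {f : α → ℝ} (hf : Summable f) :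
    ENNReal.ofReal (∑' k, f k) ≤ ∑' k, ENNReal.ofReal (f k) := by
  have h : Summable fun k => max (f k) 0 := Summable.of_norm_bounded hf.abs fun k => by
    rw [Real.norm_eq_abs, abs_of_nonneg (le_max_right _ _)]
    exact max_le (le_abs_self _) (abs_nonneg _)
  calc _ ≤ ENNReal.ofReal (∑' k, max (f k) 0) :=
        ENNReal.ofReal_le_ofReal (hf.tsum_le_tsum (fun k => le_max_left _ _) h)
    _ = ∑' k, ENNReal.ofReal (max (f k) 0) :=
        ENNReal.ofReal_tsum_of_nonneg (fun k => le_max_right _ _) h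
    _ = _ := by simp [ENNReal.ofReal_max]

theorem summable_mul_toReal_pmf {f u : ℤ → ℝ} {M : ℝ} (p : PMF ℤ) (hf : Summable fun k => |f k|)
    (hu : ∀ k, |u k| ≤ M) :
    Summable fun z : ℤ × ℤ => u z.1 * ((p (z.1 - z.2)).toReal * f z.2) := by
  have h := (hasSum_toReal_pmf p).summable.mul_of_nonneg hf (fun _ => ENNReal.toReal_nonneg)
    (fun _ => abs_nonneg _)
  -- This shear turns the convolution family into a product family.
  let e : ℤ × ℤ ≃ ℤ × ℤ :=
    { toFun := fun z => (z.1 - z.2, z.2)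
      invFun := fun z => (z.1 + z.2, z.2)
      left_inv := fun z => by simp
      right_inv := fun z => by simp }
  refine Summable.of_norm_bounded ((e.summable_iff.2 h).mul_left M) fun z => ?_
  simp only [Function.comp_apply, norm_mul, Real.norm_eq_abs, ENNReal.abs_toReal, e,
    Equiv.coe_fn_mk]
  exact mul_le_mul_of_nonneg_right (hu _) (by positivity)

theorem summable_abs_of_mem {f : H} (hf : f ∈ H₁) : Summable fun k => |f k| := by
  simpa only [abs_of_nonneg (hf.1 _)] using hf.2.summable

/-- Integrating a bounded function against the mixture density. -/
theorem hasSum_mul_mixDensity (p : PMF ℤ) {f : H} (hf : f ∈ H₁) {u : ℤ → ℝ} {M : ℝ}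
    (hu : ∀ k, |u k| ≤ M) :
    HasSum (fun x => u x * mixDensity p f x)
      (∑' θ, (∑' j, u (j + θ) * (p j).toReal) * f θ) := by
  -- Fubini: absolute summability over pairs `(x, θ)` lets the double sum be taken in either order.
  have hs := summable_mul_toReal_pmf p (summable_abs_of_mem hf) hu
  have h₁ := hs.hasSum.prod_fiberwise (fun x => (hs.prod_factor x).hasSum)
  have h₂ := ((Equiv.prodComm ℤ ℤ).hasSum_iff.2 hs.hasSum)
  have h₃ := h₂.prod_fiberwise (fun θ => (h₂.summable.prod_factor θ).hasSum)
  simp only [Function.comp_apply, Equiv.prodComm_apply, Prod.fst_swap, Prod.snd_swap] at h₃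
  have e : (fun θ => ∑' x, u x * ((p (x - θ)).toReal * f θ)) =
      fun θ => (∑' j, u (j + θ) * (p j).toReal) * f θ := by
    funext θ
    rw [← tsum_mul_right, ← (Equiv.addRight θ).tsum_eq]
    simp [mul_assoc]
  rw [e] at h₃
  simp only [tsum_mul_left] at h₁
  rw [h₃.tsum_eq]
  exact h₁

theorem hasSum_mixDensity (p : PMF ℤ) {f : H} (hf : f ∈ H₁) : HasSum (mixDensity p f) 1 := by
  have h := hasSum_mul_mixDensity p hf (u := fun _ => 1) (M := 1) (by simp)
  simpa [(hasSum_toReal_pmf p).tsum_eq, hf.2.tsum_eq] using h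

theorem mixDensity_nonneg (p : PMF ℤ) {f : H} (hf : f ∈ H₁) (x : ℤ) : 0 ≤ mixDensity p f x :=
  tsum_nonneg fun θ => mul_nonneg ENNReal.toReal_nonneg (hf.1 θ)

theorem mixDensity_add_smul (p : PMF ℤ) {f g : H} (hf : f ∈ H₁) (hg : g ∈ H₁) (a b : ℝ) (x : ℤ) :
    mixDensity p (a • f + b • g) x = a * mixDensity p f x + b * mixDensity p g x := by
  have hs : ∀ {f : H}, f ∈ H₁ → Summable fun θ => (p (x - θ)).toReal * f θ := fun hf => by
    simpa using (summable_mul_toReal_pmf p (summable_abs_of_mem hf) (u := fun _ => 1) (M := 1)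
      (by simp)).prod_factor x
  unfold mixDensity
  rw [← tsum_mul_left, ← tsum_mul_left, ← ((hs hf).mul_left a).tsum_add ((hs hg).mul_left b)]
  refine tsum_congr fun θ => ?_
  simp only [lp.coeFn_add, lp.coeFn_smul, Pi.add_apply, Pi.smul_apply, smul_eq_mul]
  ring

theorem mixLaw_singleton (p : PMF ℤ) (f : H) (x : ℤ) :
    mixLaw p f {x} = ENNReal.ofReal (mixDensity p f x) := by
  simp [mixLaw, withDensity_apply]

theorem isProbabilityMeasure_mixLaw (p : PMF ℤ) {f : H} (hf : f ∈ H₁) :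
    IsProbabilityMeasure (mixLaw p f) := by
  refine ⟨?_⟩
  rw [mixLaw, withDensity_apply _ .univ, Measure.restrict_univ, lintegral_count,
    ← ENNReal.ofReal_tsum_of_nonneg (mixDensity_nonneg p hf) (hasSum_mixDensity p hf).summable,
    (hasSum_mixDensity p hf).tsum_eq, ENNReal.ofReal_one]

theorem convex_H₁ : Convex ℝ H₁ := by
  intro f hf g hg a b ha hb hab
  refine ⟨fun k => ?_, ?_⟩
  · exact add_nonneg (mul_nonneg ha (hf.1 k)) (mul_nonneg hb (hg.1 k))
  · have h := (hf.2.mul_left a).add (hg.2.mul_left b)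
    rw [mul_one, mul_one, hab] at h
    exact h

/-! ### Quadratic risk and its lower bound over a segment -/

theorem mise_eq_lintegral_enorm (p : PMF ℤ) {n : ℕ} (g : (Fin n → ℤ) → H) (f : H) :
    mise p g f = ∫⁻ x, ‖g x - f‖ₑ ^ 2 ∂(sampleLaw p f n) := by
  unfold mise
  congr with x
  rw [ENNReal.ofReal_pow (norm_nonneg _), ofReal_norm]

theorem hasSum_sq_norm (f : H) : HasSum (fun l => f l ^ 2) (‖f‖ ^ 2) := by
  simpa using lp.hasSum_norm (p := 2) (by simp) f

/-- Two-point lower bound around the midpoint of a segment. -/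
theorem ofReal_le_maxMise_segment (p : PMF ℤ) {f₀ f₁ : H} (h₀ : f₀ ∈ H₁) (h₁ : f₁ ∈ H₁) {n : ℕ}
    (g : (Fin n → ℤ) → H) {h : ℝ} (hh : h ^ 2 ≤ 1 / 4)
    (hn : 2 * h ^ 2 * (∑' l, |mixDensity p f₁ l - mixDensity p f₀ l|) * n ≤ 1 / 2) :
    ENNReal.ofReal (h ^ 2 * ‖f₁ - f₀‖ ^ 2 / 4) ≤ maxMise p g (segment ℝ f₀ f₁) := by
  obtain ⟨hh₁, hh₂⟩ := abs_le.1 (abs_le_of_sq_le_sq (by norm_num; exact hh) (by norm_num) :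
    |h| ≤ 1 / 2)
  set a : H := (1 / 2 + h) • f₀ + (1 / 2 - h) • f₁ with ha
  set b : H := (1 / 2 - h) • f₀ + (1 / 2 + h) • f₁ with hb
  have has : a ∈ segment ℝ f₀ f₁ :=
    ⟨1 / 2 + h, 1 / 2 - h, by linarith, by linarith, by ring, rfl⟩
  have hbs : b ∈ segment ℝ f₀ f₁ :=
    ⟨1 / 2 - h, 1 / 2 + h, by linarith, by linarith, by ring, rfl⟩
  have ha₁ : a ∈ H₁ := convex_H₁.segment_subset h₀ h₁ has
  have hb₁ : b ∈ H₁ := convex_H₁.segment_subset h₀ h₁ hbs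
  have := isProbabilityMeasure_mixLaw p ha₁
  have := isProbabilityMeasure_mixLaw p hb₁
  have : IsProbabilityMeasure (sampleLaw p a n) := by unfold sampleLaw; infer_instance
  have : IsProbabilityMeasure (sampleLaw p b n) := by unfold sampleLaw; infer_instance
  set c := ∑' l, |mixDensity p f₁ l - mixDensity p f₀ l| with hc
  have hc0 : 0 ≤ c := tsum_nonneg fun _ => abs_nonneg _
  let η : Measure ℤ := Measure.count.withDensity
    fun x => ENNReal.ofReal (√(mixDensity p a x * mixDensity p b x))
  have : SigmaFinite η := SigmaFinite.withDensity_ofReal _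
  have hη : ∀ x, η {x} ≤ mixLaw p a {x} ^ (1 / 2 : ℝ) * mixLaw p b {x} ^ (1 / 2 : ℝ) := fun x => by
    have e₁ := mixDensity_nonneg p ha₁ x
    have e₂ := mixDensity_nonneg p hb₁ x
    rw [mixLaw_singleton, mixLaw_singleton, ENNReal.ofReal_rpow_of_nonneg e₁ (by norm_num),
      ENNReal.ofReal_rpow_of_nonneg e₂ (by norm_num), ← ENNReal.ofReal_mul (by positivity),
      ← Real.mul_rpow e₁ e₂, ← Real.sqrt_eq_rpow]
    simp [η, withDensity_apply]
  have hηu : ENNReal.ofReal (1 - 2 * h ^ 2 * c) ≤ η Set.univ := by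
    have s₀ := hasSum_mixDensity p h₀
    have s₁ := hasSum_mixDensity p h₁
    -- Summing the pointwise bound of `half_add_sub_le_sqrt`: the averaged densities have mass 1,
    -- leaving `1 - 2 * h ^ 2 * c`.
    have s := ((s₀.add s₁).div_const 2).sub
      ((s₁.summable.sub s₀.summable).abs.hasSum.mul_left (2 * h ^ 2))
    rw [show ((1 : ℝ) + 1) / 2 = 1 by norm_num] at s
    rw [withDensity_apply _ .univ, Measure.restrict_univ, lintegral_count, hc, ← s.tsum_eq]
    refine (ofReal_tsum_le s.summable).trans (ENNReal.tsum_le_tsum fun x => ?_)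
    apply ENNReal.ofReal_le_ofReal
    rw [ha, hb, mixDensity_add_smul p h₀ h₁, mixDensity_add_smul p h₀ h₁]
    exact half_add_sub_le_sqrt (mixDensity_nonneg p h₀ x) (mixDensity_nonneg p h₁ x) hh
  -- For `n = 0` the hypothesis `hn` does not control `c`, but the empty product measure has mass 1
  -- anyway.
  have hpow : (1 / 2 : ℝ) ≤ (1 - 2 * h ^ 2 * c) ^ n ∧ 0 ≤ 1 - 2 * h ^ 2 * c ∨ n = 0 := by
    rcases Nat.eq_zero_or_pos n with rfl | hn0
    · exact .inr rfl
    have hn1 : (1 : ℝ) ≤ n := by exact_mod_cast hn0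
    have hle : 2 * h ^ 2 * c ≤ 1 / 2 := le_trans (le_mul_of_one_le_right (by positivity) hn1) hn
    refine .inl ⟨?_, by linarith⟩
    have := one_add_mul_le_pow (a := -(2 * h ^ 2 * c)) (by linarith) n
    rw [← sub_eq_add_neg] at this
    linarith
  have hηn : ENNReal.ofReal (1 / 2) ≤ Measure.pi (fun _ : Fin n => η) Set.univ := by
    rw [Measure.pi_univ, Finset.prod_const, Finset.card_univ, Fintype.card_fin]
    rcases hpow with ⟨h₂, h₃⟩ | rfl
    · calc _ ≤ ENNReal.ofReal ((1 - 2 * h ^ 2 * c) ^ n) := ENNReal.ofReal_le_ofReal h₂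
        _ = ENNReal.ofReal (1 - 2 * h ^ 2 * c) ^ n := ENNReal.ofReal_pow h₃ n
        _ ≤ _ := by gcongr
    · simp
  have key := enorm_sub_sq_mul_le_of_singleton_le
    (μ := sampleLaw p a n) (ν := sampleLaw p b n)
    (pi_singleton_le_of_singleton_le (ι := Fin n) hη) g a b
    (R := maxMise p g (segment ℝ f₀ f₁))
    (by rw [← mise_eq_lintegral_enorm]; exact le_iSup₂ (f := fun f _ => mise p g f) a has)
    (by rw [← mise_eq_lintegral_enorm]; exact le_iSup₂ (f := fun f _ => mise p g f) b hbs)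
  have hab : ‖a - b‖ = 2 * |h| * ‖f₁ - f₀‖ := by
    have : a - b = (-(2 * h)) • (f₁ - f₀) := by rw [ha, hb]; module
    rw [this, norm_smul]; simp
  have : ENNReal.ofReal (4 * (h ^ 2 * ‖f₁ - f₀‖ ^ 2 / 4)) ≤
      4 * maxMise p g (segment ℝ f₀ f₁) := by
    calc _ = (ENNReal.ofReal ‖a - b‖ * ENNReal.ofReal (1 / 2)) ^ 2 := by
          rw [hab, ← ENNReal.ofReal_mul (by positivity), ← ENNReal.ofReal_pow (by positivity)]
          congr 1
          rw [mul_pow, mul_pow, mul_pow, sq_abs]; ring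
      _ ≤ (‖a - b‖ₑ * Measure.pi (fun _ : Fin n => η) Set.univ) ^ 2 := by
          rw [ofReal_norm]; gcongr
      _ ≤ _ := key
  rw [ENNReal.ofReal_mul (by norm_num), ENNReal.ofReal_ofNat] at this
  exact (ENNReal.mul_le_mul_iff_right (by norm_num) (by norm_num)).1 this

/-- The lower bound over a segment. -/
theorem ofReal_le_minimaxMise_segment (p : PMF ℤ) {f₀ f₁ : H} (h₀ : f₀ ∈ H₁) (h₁ : f₁ ∈ H₁)
    (n : ℕ) :
    ENNReal.ofReal ((∑' l : ℤ, (f₁ l - f₀ l) ^ 2) *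
        (16 + 16 * (∑' l : ℤ, |mixDensity p f₁ l - mixDensity p f₀ l|) * n)⁻¹)
      ≤ minimaxMise p n (segment ℝ f₀ f₁) := by
  refine le_iInf₂ fun g _ => ?_
  set c := ∑' l, |mixDensity p f₁ l - mixDensity p f₀ l| with hc
  have hc0 : 0 ≤ c := tsum_nonneg fun _ => abs_nonneg _
  have hcn : 0 ≤ c * n := by positivity
  -- This offset satisfies both `h ^ 2 ≤ 1 / 4` and `2 * h ^ 2 * c * n ≤ 1 / 2`; then `h ^ 2 / 4 = 1
  -- / (16 + 16 * c * n)` gives the two constants 16.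
  have hsq : √(1 / (4 + 4 * (c * n))) ^ 2 = 1 / (4 + 4 * (c * n)) := Real.sq_sqrt (by positivity)
  have := ofReal_le_maxMise_segment p h₀ h₁ g (h := √(1 / (4 + 4 * (c * n))))
    (by
      rw [hsq]
      exact one_div_le_one_div_of_le (by norm_num) (by linarith))
    (by
      rw [hsq, ← hc, show 2 * (1 / (4 + 4 * (c * n))) * c * n = 2 * (c * n) / (4 + 4 * (c * n)) by
        ring, div_le_iff₀ (by positivity)]
      linarith)
  refine le_of_eq_of_le (congrArg ENNReal.ofReal ?_) this
  rw [hsq, ← (hasSum_sq_norm (f₁ - f₀)).tsum_eq]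
  simp only [lp.coeFn_sub, Pi.sub_apply]
  field_simp
  ring

/-! ### The Fourier series of the error law -/

theorem norm_exp_neg_I_mul (k : ℤ) (t : ℝ) : ‖Complex.exp (-(Complex.I * k * t))‖ = 1 := by
  rw [show -(Complex.I * k * t) = ((-(k * t) : ℝ) : ℂ) * Complex.I by push_cast; ring,
    Complex.norm_exp_ofReal_mul_I]

theorem norm_exp_I_mul (k : ℤ) (t : ℝ) : ‖Complex.exp (Complex.I * k * t)‖ = 1 := by
  rw [show Complex.I * k * t = ((k * t : ℝ) : ℂ) * Complex.I by push_cast; ring,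
    Complex.norm_exp_ofReal_mul_I]

theorem norm_pStar_term (p : PMF ℤ) (k : ℤ) (t : ℝ) :
    ‖(((p k).toReal : ℝ) : ℂ) * Complex.exp (-(Complex.I * k * t))‖ = (p k).toReal := by
  rw [norm_mul, norm_exp_neg_I_mul, mul_one, Complex.norm_real, Real.norm_eq_abs,
    ENNReal.abs_toReal]

theorem hasSum_pStar (p : PMF ℤ) (t : ℝ) :
    HasSum (fun k : ℤ => (((p k).toReal : ℝ) : ℂ) * Complex.exp (-(Complex.I * k * t)))
      (pStar p t) :=
  (Summable.of_norm_bounded (hasSum_toReal_pmf p).summable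
    fun k => (norm_pStar_term p k t).le).hasSum

theorem continuous_pStar (p : PMF ℤ) : Continuous (pStar p) :=
  continuous_tsum (fun k => by fun_prop) (hasSum_toReal_pmf p).summable
    fun k t => (norm_pStar_term p k t).le

theorem conj_pStar (p : PMF ℤ) (t : ℝ) : (starRingEnd ℂ) (pStar p t) = pStar p (-t) := by
  unfold pStar fourierSeries
  rw [Complex.conj_tsum]
  refine tsum_congr fun k => ?_
  rw [map_mul, ← Complex.exp_conj, Complex.conj_ofReal]
  simp

theorem measurable_inv_pStar (p : PMF ℤ) : Measurable fun t => (pStar p t)⁻¹ :=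
  (continuous_pStar p).measurable.inv

/-- Strict only at `z = 0`, where the complex inverse is 0 and the extended one is `∞`. -/
theorem enorm_inv_sq_le (z : ℂ) : ‖z⁻¹‖ₑ ^ 2 ≤ (‖z‖ₑ ^ 2)⁻¹ := by
  rcases eq_or_ne z 0 with rfl | h
  · simp
  · rw [enorm_inv h, ENNReal.inv_pow]

theorem lintegral_enorm_inv_pStar_le (p : PMF ℤ) :
    ∫⁻ t in Set.Ioc (-Real.pi) Real.pi, ‖(pStar p t)⁻¹‖ₑ ^ 2 ≤ Kp p :=
  lintegral_mono fun _ => enorm_inv_sq_le _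

variable {p : PMF ℤ}

theorem memLp_inv_pStar (hp : Kp p < ∞) :
    MemLp (fun t => (pStar p t)⁻¹) 2 (volume.restrict (Set.Ioc (-Real.pi) Real.pi)) := by
  refine ⟨(measurable_inv_pStar p).aestronglyMeasurable, ?_⟩
  rw [eLpNorm_lt_top_iff_lintegral_rpow_enorm_lt_top (by norm_num) (by norm_num)]
  simpa using (lintegral_enorm_inv_pStar_le p).trans_lt hp

/-- The integrand of `Kp` is `∞` at zeros of `p*`, so finiteness of the integral makes the zeros
negligible. -/
theorem ae_pStar_ne_zero (hp : Kp p < ∞) :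
    ∀ᵐ t ∂(volume.restrict (Set.Ioc (-Real.pi) Real.pi)), pStar p t ≠ 0 := by
  have h := ae_lt_top (((continuous_pStar p).measurable.enorm.pow_const 2).inv) hp.ne
  filter_upwards [h] with t ht h0
  simp [h0] at ht

theorem intervalIntegrable_inv_pStar (hp : Kp p < ∞) :
    IntervalIntegrable (fun t => (pStar p t)⁻¹) volume (-Real.pi) Real.pi := by
  rw [intervalIntegrable_iff_integrableOn_Ioc_of_le (by linarith [Real.pi_pos])]
  exact (memLp_inv_pStar hp).integrable (by norm_num)

theorem intervalIntegrable_exp_div_pStar (hp : Kp p < ∞) (k : ℤ) :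
    IntervalIntegrable (fun t : ℝ => Complex.exp (Complex.I * k * t) / pStar p t) volume
      (-Real.pi) Real.pi := by
  simp only [div_eq_mul_inv]
  exact (intervalIntegrable_inv_pStar hp).continuousOn_mul (by fun_prop)

/-! ### The deconvolution kernel -/

variable (p) in
/-- The complex Fourier coefficients of `1 / p*`. -/
def complexKernel (k : ℤ) : ℂ :=
  (1 / (2 * Real.pi) : ℂ) * ∫ t in (-Real.pi)..Real.pi,
    Complex.exp (Complex.I * k * t) / pStar p t

variable (p) in
/-- The deconvolution kernel: the sequence with Fourier series `1 / p*`. -/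
def kernel (k : ℤ) : ℝ := (complexKernel p k).re

/-- Since `p` is real, conjugation acts on the integrand as `t ↦ -t`, which preserves the symmetric
interval. -/
theorem conj_complexKernel (k : ℤ) : (starRingEnd ℂ) (complexKernel p k) = complexKernel p k := by
  have h := intervalIntegral.integral_comp_neg (a := -Real.pi) (b := Real.pi)
    fun t : ℝ => Complex.exp (Complex.I * k * t) / pStar p t
  rw [neg_neg] at h
  rw [complexKernel, map_mul, ← intervalIntegral.intervalIntegral_conj, ← h]
  congr 1
  · simpa using Complex.conj_ofNat 2
  · congr with t
    rw [map_div₀, conj_pStar, ← Complex.exp_conj]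
    simp

theorem ofReal_kernel (k : ℤ) : ((kernel p k : ℝ) : ℂ) = complexKernel p k :=
  Complex.conj_eq_iff_re.1 (conj_complexKernel k)

/-- Parseval for `1 / p*`, which is square integrable. -/
theorem exists_hasSum_sq_kernel (hp : Kp p < ∞) :
    ∃ S : ℝ, HasSum (fun k => kernel p k ^ 2) S ∧
      ENNReal.ofReal S ≤ Kp p / ENNReal.ofReal (2 * Real.pi) := by
  have hab : -Real.pi < Real.pi := by linarith [Real.pi_pos]
  have h := hasSum_sq_fourierCoeffOn hab (memLp_inv_pStar hp)
  -- `fourierCoeffOn` integrates against `e^{-ikt}`, the kernel against `e^{ikt}`; hence the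
  -- reflection.
  have e : ∀ k, ‖fourierCoeffOn hab (fun t => (pStar p t)⁻¹) k‖ ^ 2 = kernel p (-k) ^ 2 := by
    intro k
    have : fourierCoeffOn hab (fun t => (pStar p t)⁻¹) k = ((kernel p (-k) : ℝ) : ℂ) := by
      rw [fourierCoeffOn_eq_integral, ofReal_kernel, complexKernel, Complex.real_smul]
      congr 1
      · push_cast; ring
      · refine intervalIntegral.integral_congr fun t _ => ?_
        simp only [fourier_coe_apply, smul_eq_mul, div_eq_mul_inv]
        congr 2
        have : (Real.pi : ℂ) ≠ 0 := by exact_mod_cast Real.pi_ne_zero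
        push_cast
        field_simp
        ring
    rw [this, Complex.norm_real, Real.norm_eq_abs, sq_abs]
  simp only [e] at h
  refine ⟨_, (Equiv.neg ℤ).hasSum_iff.1 h, ?_⟩
  rw [intervalIntegral.integral_of_le hab.le, smul_eq_mul,
    show Real.pi - -Real.pi = 2 * Real.pi by ring, ENNReal.ofReal_mul (by positivity),
    ENNReal.ofReal_inv_of_pos (by positivity), mul_comm, ← div_eq_mul_inv]
  gcongr
  rw [ofReal_integral_eq_lintegral_ofReal (memLp_inv_pStar hp).integrable_norm_pow'
    (.of_forall fun _ => by positivity)]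
  refine le_trans (le_of_eq ?_) (lintegral_enorm_inv_pStar_le p)
  congr with t
  rw [ENNReal.ofReal_pow (norm_nonneg _), ofReal_norm]

theorem integral_exp_I_mul (k : ℤ) :
    ∫ t in (-Real.pi)..Real.pi, Complex.exp (Complex.I * k * t) =
      if k = 0 then 2 * (Real.pi : ℂ) else 0 := by
  split_ifs with h
  · simp [h]; ring
  · have hk : (Complex.I * k : ℂ) ≠ 0 := mul_ne_zero Complex.I_ne_zero (by exact_mod_cast h)
    rw [integral_exp_mul_complex hk, div_eq_zero_iff, sub_eq_zero]
    left
    rw [Complex.exp_eq_exp_iff_exists_int]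
    exact ⟨k, by push_cast; ring⟩

/-- The kernel inverts convolution with `p`. -/
theorem tsum_kernel_sub_mul (hp : Kp p < ∞) (k : ℤ) :
    ∑' j, kernel p (k - j) * (p j).toReal = if k = 0 then 1 else 0 := by
  -- Termwise integration, with majorant `|1 / p*|`. The series sums to `e^{ikt} p* / p*`, which is
  -- `e^{ikt}` for almost every `t`.
  have h := intervalIntegral.hasSum_integral_of_dominated_convergence (μ := volume)
    (a := -Real.pi) (b := Real.pi)
    (F := fun (j : ℤ) (t : ℝ) => (((p j).toReal : ℝ) : ℂ) *
      (Complex.exp (Complex.I * (k - j : ℤ) * t) / pStar p t))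
    (f := fun t : ℝ => Complex.exp (Complex.I * k * t))
    (fun j t => (p j).toReal * ‖(pStar p t)⁻¹‖)
    (fun j => by
      refine (Measurable.const_mul (Measurable.div ?_ (continuous_pStar p).measurable)
        _).aestronglyMeasurable
      fun_prop)
    (fun j => .of_forall fun t _ => by
      rw [norm_mul, norm_div, norm_exp_I_mul, Complex.norm_real, Real.norm_eq_abs,
        ENNReal.abs_toReal, norm_inv, one_div])
    (.of_forall fun t _ => (hasSum_toReal_pmf p).summable.mul_right _)
    (by
      simp only [tsum_mul_right, (hasSum_toReal_pmf p).tsum_eq, one_mul]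
      exact (intervalIntegrable_inv_pStar hp).norm)
    (by
      have := (ae_restrict_iff' measurableSet_Ioc).1 (ae_pStar_ne_zero hp)
      filter_upwards [this] with t ht hmem
      rw [Set.uIoc_of_le (by linarith [Real.pi_pos])] at hmem
      have h := (hasSum_pStar p t).mul_left (Complex.exp (Complex.I * k * t) / pStar p t)
      rw [div_mul_cancel₀ _ (ht hmem)] at h
      refine h.congr_fun fun j => ?_
      rw [show Complex.I * (k - j : ℤ) * t = Complex.I * k * t + -(Complex.I * j * t) by
        push_cast; ring, Complex.exp_add]
      ring)
  have h₂ := h.mul_left (1 / (2 * Real.pi) : ℂ)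
  rw [integral_exp_I_mul] at h₂
  have e : (fun j : ℤ => (1 / (2 * Real.pi) : ℂ) * ∫ t in (-Real.pi)..Real.pi,
      (((p j).toReal : ℝ) : ℂ) * (Complex.exp (Complex.I * (k - j : ℤ) * t) / pStar p t)) =
      fun j => ((kernel p (k - j) * (p j).toReal : ℝ) : ℂ) := by
    funext j
    rw [intervalIntegral.integral_const_mul, Complex.ofReal_mul, ofReal_kernel, complexKernel]
    ring
  rw [e] at h₂
  have h₃ := h₂.tsum_eq
  rw [← Complex.ofReal_tsum] at h₃
  have hpi : (Real.pi : ℂ) ≠ 0 := by exact_mod_cast Real.pi_ne_zero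
  split_ifs at h₃ ⊢
  · rw [one_div, inv_mul_cancel₀ (mul_ne_zero two_ne_zero hpi)] at h₃
    exact_mod_cast h₃
  · rw [mul_zero] at h₃
    exact_mod_cast h₃

/-! ### The estimator as an average of translated kernels -/

theorem fourierSeries_empirical {n : ℕ} (x : Fin n → ℤ) (t : ℝ) :
    fourierSeries (empirical x) t =
      (1 / n : ℂ) * ∑ i, Complex.exp (-(Complex.I * x i * t)) := by
  have h : HasSum (fun k : ℤ => ∑ i, (1 / n : ℂ) *
      if k = x i then Complex.exp (-(Complex.I * k * t)) else 0)
      (∑ i, (1 / n : ℂ) * Complex.exp (-(Complex.I * x i * t))) :=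
    hasSum_sum fun i _ => by
      refine HasSum.mul_left _ ?_
      simpa using hasSum_single (f := fun k : ℤ =>
        if k = x i then Complex.exp (-(Complex.I * k * t)) else 0) (x i) fun k hk => if_neg hk
  rw [Finset.mul_sum, ← h.tsum_eq]
  refine tsum_congr fun k => ?_
  simp only [empirical]
  push_cast
  rw [mul_assoc, Finset.sum_mul, Finset.mul_sum]
  refine Finset.sum_congr rfl fun i _ => ?_
  by_cases h : x i = k
  · simp [h]
  · simp [h, Ne.symm h]

theorem fourierCoefficient_eq (hp : Kp p < ∞) {n : ℕ} (x : Fin n → ℤ) (k : ℤ) :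
    fourierCoefficient p x k = (((1 / n : ℝ) * ∑ i, kernel p (k - x i) : ℝ) : ℂ) := by
  have e : ∀ t : ℝ, fourierSeries (empirical x) t / pStar p t * Complex.exp (Complex.I * k * t) =
      (1 / n : ℂ) * ∑ i, Complex.exp (Complex.I * (k - x i : ℤ) * t) / pStar p t := by
    intro t
    rw [fourierSeries_empirical, mul_div_assoc, Finset.sum_div, mul_assoc, Finset.sum_mul]
    congr 1
    refine Finset.sum_congr rfl fun i _ => ?_
    rw [show Complex.I * (k - x i : ℤ) * t = -(Complex.I * x i * t) + Complex.I * k * t by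
        push_cast; ring, Complex.exp_add]
    ring
  rw [fourierCoefficient]
  simp only [e]
  rw [intervalIntegral.integral_const_mul,
    intervalIntegral.integral_finsetSum fun i _ => intervalIntegrable_exp_div_pStar hp _]
  rw [Complex.ofReal_mul, Complex.ofReal_sum]
  simp only [ofReal_kernel, complexKernel]
  rw [← Finset.mul_sum]
  push_cast
  rw [mul_left_comm]

theorem abs_kernel_le (hp : Kp p < ∞) : ∃ M : ℝ, ∀ k, |kernel p k| ≤ M := by
  obtain ⟨S, hS, -⟩ := exists_hasSum_sq_kernel hp
  exact ⟨√S, fun k => Real.abs_le_sqrt (le_hasSum hS k fun _ _ => sq_nonneg _)⟩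

theorem hasSum_sq_kernel_sub {S : ℝ} (hS : HasSum (fun k => kernel p k ^ 2) S) (j : ℤ) :
    HasSum (fun k => kernel p (k - j) ^ 2) S :=
  (Equiv.subRight j).hasSum_iff (f := fun k => kernel p k ^ 2) |>.2 hS

theorem memℓp_average_kernel (hp : Kp p < ∞) {n : ℕ} (x : Fin n → ℤ) :
    Memℓp (fun k => (1 / n : ℝ) * ∑ i, kernel p (k - x i)) 2 := by
  obtain ⟨S, hS, -⟩ := exists_hasSum_sq_kernel hp
  refine Memℓp.const_mul (Memℓp.finsetSum _ fun i _ => memℓp_gen ?_) _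
  simpa using (hasSum_sq_kernel_sub hS (x i)).summable

/-- The averaged kernel is real and square summable, so the default value 0 is never used. -/
theorem coe_fourierEstimator (hp : Kp p < ∞) {n : ℕ} (x : Fin n → ℤ) (k : ℤ) :
    ((fourierEstimator p n x k : ℝ) : ℂ) = fourierCoefficient p x k := by
  have h : ∃ g : H, ∀ k : ℤ, ((g k : ℝ) : ℂ) = fourierCoefficient p x k :=
    ⟨⟨_, memℓp_average_kernel hp x⟩, fun k => (fourierCoefficient_eq hp x k).symm⟩
  rw [fourierEstimator, dif_pos h]
  exact h.choose_spec k

theorem fourierEstimator_apply (hp : Kp p < ∞) {n : ℕ} (x : Fin n → ℤ) (k : ℤ) :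
    fourierEstimator p n x k = (1 / n : ℝ) * ∑ i, kernel p (k - x i) := by
  have h := coe_fourierEstimator hp x k
  rw [fourierCoefficient_eq hp] at h
  exact_mod_cast h

theorem fourierEstimator_mem_estimators (p : PMF ℤ) (n : ℕ) :
    fourierEstimator p n ∈ estimators n := fun _ _ => MeasurableSet.of_discrete

/-! ### Unbiasedness and risk of the estimator -/

theorem memLp_kernel_sub (hp : Kp p < ∞) {f : H} (hf : f ∈ H₁) (k : ℤ) (q : ℝ≥0∞) :
    MemLp (fun x => kernel p (k - x)) q (mixLaw p f) := by
  have := isProbabilityMeasure_mixLaw p hf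
  obtain ⟨M, hM⟩ := abs_kernel_le hp
  exact MemLp.of_bound Measurable.of_discrete.aestronglyMeasurable M (.of_forall fun x => hM _)

theorem integral_kernel_sub (hp : Kp p < ∞) {f : H} (hf : f ∈ H₁) (k : ℤ) :
    ∫ x, kernel p (k - x) ∂(mixLaw p f) = f k := by
  have := isProbabilityMeasure_mixLaw p hf
  have hint := (memLp_kernel_sub hp hf k 1).integrable le_rfl
  obtain ⟨M, hM⟩ := abs_kernel_le hp
  rw [integral_countable hint]
  have h := hasSum_mul_mixDensity p hf (u := fun x => kernel p (k - x)) fun x => hM _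
  have e : ∀ θ, ∑' j, kernel p (k - (j + θ)) * (p j).toReal = if θ = k then 1 else 0 := by
    intro θ
    have := tsum_kernel_sub_mul hp (k - θ)
    simp only [sub_eq_zero, eq_comm (a := k)] at this
    rw [← this]
    exact tsum_congr fun j => by rw [sub_sub, add_comm]
  simp only [e, ite_mul, one_mul, zero_mul, tsum_ite_eq] at h
  rw [← h.tsum_eq]
  refine tsum_congr fun x => ?_
  rw [measureReal_def, mixLaw_singleton, ENNReal.toReal_ofReal (mixDensity_nonneg p hf x),
    smul_eq_mul, mul_comm]

theorem integrable_kernel_sub_eval (hp : Kp p < ∞) {f : H} (hf : f ∈ H₁) {n : ℕ} (k : ℤ)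
    (i : Fin n) : Integrable (fun x => kernel p (k - x i)) (sampleLaw p f n) := by
  have := isProbabilityMeasure_mixLaw p hf
  exact integrable_comp_eval (i := i) (μ := fun _ : Fin n => mixLaw p f)
    (f := fun y => kernel p (k - y)) ((memLp_kernel_sub hp hf k 1).integrable le_rfl)

theorem integrable_fourierEstimator (hp : Kp p < ∞) {f : H} (hf : f ∈ H₁) (n : ℕ) (k : ℤ) :
    Integrable (fun x => fourierEstimator p n x k) (sampleLaw p f n) := by
  simp only [fourierEstimator_apply hp]
  exact (integrable_finsetSum _ fun i _ => integrable_kernel_sub_eval hp hf k i).const_mul _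

theorem integral_fourierEstimator (hp : Kp p < ∞) {f : H} (hf : f ∈ H₁) {n : ℕ} (hn : 0 < n)
    (k : ℤ) : ∫ x, fourierEstimator p n x k ∂(sampleLaw p f n) = f k := by
  have := isProbabilityMeasure_mixLaw p hf
  simp only [fourierEstimator_apply hp]
  rw [integral_const_mul, integral_finsetSum _ fun i _ => integrable_kernel_sub_eval hp hf k i]
  have e : ∀ i : Fin n, ∫ x, kernel p (k - x i) ∂(sampleLaw p f n) = f k := fun i => by
    exact (integral_comp_eval (i := i) (μ := fun _ : Fin n => mixLaw p f)
      (f := fun y => kernel p (k - y)) Measurable.of_discrete.aestronglyMeasurable).trans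
        (integral_kernel_sub hp hf k)
  have : (n : ℝ) ≠ 0 := by positivity
  simp [e, this]

theorem lintegral_sq_fourierEstimator_sub_le (hp : Kp p < ∞) {f : H} (hf : f ∈ H₁) {n : ℕ}
    (hn : 0 < n) (k : ℤ) :
    ∫⁻ x, ENNReal.ofReal ((fourierEstimator p n x k - f k) ^ 2) ∂(sampleLaw p f n) ≤
      ENNReal.ofReal (1 / n) * ∫⁻ x, ENNReal.ofReal (kernel p (k - x) ^ 2) ∂(mixLaw p f) := by
  have := isProbabilityMeasure_mixLaw p hf
  have : IsProbabilityMeasure (sampleLaw p f n) := by unfold sampleLaw; infer_instance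
  have hn' : (n : ℝ) ≠ 0 := by positivity
  have hY := memLp_kernel_sub hp hf k 2
  have hvar : ProbabilityTheory.variance (fun x => fourierEstimator p n x k) (sampleLaw p f n) =
      (1 / n) * ProbabilityTheory.variance (fun x => kernel p (k - x)) (mixLaw p f) := by
    simp only [fourierEstimator_apply hp]
    rw [ProbabilityTheory.variance_const_mul]
    have := ProbabilityTheory.variance_sum_pi (μ := fun _ : Fin n => mixLaw p f)
      (X := fun _ x => kernel p (k - x)) fun _ => hY
    rw [show (∑ i : Fin n, fun ω : Fin n → ℤ => kernel p (k - ω i)) =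
      fun ω => ∑ i, kernel p (k - ω i) by ext; simp] at this
    rw [sampleLaw, this]
    simp
    field_simp
  have hle := ProbabilityTheory.variance_le_expectation_sq (μ := mixLaw p f)
    (X := fun x => kernel p (k - x)) Measurable.of_discrete.aestronglyMeasurable
  have hE : MemLp (fun x => fourierEstimator p n x k) 2 (sampleLaw p f n) := by
    obtain ⟨M, hM⟩ := abs_kernel_le hp
    refine MemLp.of_bound Measurable.of_discrete.aestronglyMeasurable M (.of_forall fun x => ?_)
    rw [fourierEstimator_apply hp, norm_mul, Real.norm_eq_abs, abs_of_nonneg (by positivity),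
      one_div, inv_mul_le_iff₀ (by positivity)]
    refine (norm_sum_le_of_le _ (fun i _ => hM _)).trans_eq (by simp)
  -- Unbiasedness identifies the coordinate risk with a variance.
  have hev := hE.ofReal_variance_eq
  rw [ProbabilityTheory.evariance_eq_lintegral_ofReal, integral_fourierEstimator hp hf hn] at hev
  rw [← hev, hvar, ENNReal.ofReal_mul (by positivity)]
  gcongr
  rw [← ofReal_integral_eq_lintegral_ofReal hY.integrable_sq (.of_forall fun _ => sq_nonneg _)]
  exact ENNReal.ofReal_le_ofReal hle

/-- The upper bound on the risk of the Fourier estimator. -/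
theorem mise_fourierEstimator_le (hp : Kp p < ∞) {f : H} (hf : f ∈ H₁) {n : ℕ} (hn : 0 < n) :
    mise p (fourierEstimator p n) f ≤ Kp p / ENNReal.ofReal (2 * Real.pi * n) := by
  have := isProbabilityMeasure_mixLaw p hf
  obtain ⟨S, hS, hSK⟩ := exists_hasSum_sq_kernel hp
  have e : ∀ x : Fin n → ℤ, ENNReal.ofReal (‖fourierEstimator p n x - f‖ ^ 2) =
      ∑' k, ENNReal.ofReal ((fourierEstimator p n x k - f k) ^ 2) := fun x => by
    have h := hasSum_sq_norm (fourierEstimator p n x - f)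
    rw [← h.tsum_eq, ENNReal.ofReal_tsum_of_nonneg (fun _ => sq_nonneg _) h.summable]
    rfl
  have e₂ : ∀ x : ℤ, ∑' k, ENNReal.ofReal (kernel p (k - x) ^ 2) = ENNReal.ofReal S := fun x => by
    have h := hasSum_sq_kernel_sub hS x
    rw [← h.tsum_eq, ENNReal.ofReal_tsum_of_nonneg (fun _ => sq_nonneg _) h.summable]
  unfold mise
  simp only [e]
  rw [lintegral_tsum fun _ => Measurable.of_discrete.aemeasurable]
  calc _ ≤ ∑' k : ℤ, ENNReal.ofReal (1 / n) *
        ∫⁻ x, ENNReal.ofReal (kernel p (k - x) ^ 2) ∂(mixLaw p f) :=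
        ENNReal.tsum_le_tsum fun k => lintegral_sq_fourierEstimator_sub_le hp hf hn k
    -- For each `x` the sum over `k` is `S`, whatever the translate, so the law of the observation
    -- no longer matters.
    _ = ENNReal.ofReal (1 / n) * ENNReal.ofReal S := by
        rw [ENNReal.tsum_mul_left, ← lintegral_tsum fun _ => Measurable.of_discrete.aemeasurable]
        simp [e₂]
    _ ≤ ENNReal.ofReal (1 / n) * (Kp p / ENNReal.ofReal (2 * Real.pi)) := by gcongr
    _ = _ := by
        have hpi := Real.pi_pos
        rw [ENNReal.ofReal_mul (p := 2 * Real.pi) (by positivity), ENNReal.div_eq_inv_mul,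
          ENNReal.div_eq_inv_mul,
          ENNReal.mul_inv (.inl (by simp [hpi])) (.inl ENNReal.ofReal_ne_top),
          one_div, ENNReal.ofReal_inv_of_pos (by positivity)]
        ring

theorem maxMise_fourierEstimator_le (hp : Kp p < ∞) {n : ℕ} (hn : 0 < n) {C : Set H}
    (hC : C ⊆ H₁) :
    maxMise p (fourierEstimator p n) C ≤ Kp p / ENNReal.ofReal (2 * Real.pi * n) :=
  iSup₂_le fun _ hf => mise_fourierEstimator_le hp (hC hf) hn

/-! ### Minimax rate -/

theorem maxMise_mono (p : PMF ℤ) {n : ℕ} (g : (Fin n → ℤ) → H) {C D : Set H} (h : C ⊆ D) :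
    maxMise p g C ≤ maxMise p g D := biSup_mono h

theorem minimaxMise_mono (p : PMF ℤ) (n : ℕ) {C D : Set H} (h : C ⊆ D) :
    minimaxMise p n C ≤ minimaxMise p n D := iInf₂_mono fun g _ => maxMise_mono p g h

theorem minimaxMise_le_maxMise_fourierEstimator (p : PMF ℤ) (n : ℕ) (C : Set H) :
    minimaxMise p n C ≤ maxMise p (fourierEstimator p n) C :=
  iInf₂_le _ (fourierEstimator_mem_estimators p n)

/-- The rate `1 / n` is a lower bound over classes containing a proper segment. -/
theorem exists_div_le_minimaxMise (p : PMF ℤ) {C : Set H} {f₀ f₁ : H} (h₀ : f₀ ∈ H₁)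
    (h₁ : f₁ ∈ H₁) (hne : f₀ ≠ f₁) (hC : segment ℝ f₀ f₁ ⊆ C) :
    ∃ a : ℝ, 0 < a ∧ ∀ n : ℕ, 0 < n → ENNReal.ofReal (a / n) ≤ minimaxMise p n C := by
  have hc₀ : ∑' l : ℤ, (f₁ l - f₀ l) ^ 2 = ‖f₁ - f₀‖ ^ 2 := (hasSum_sq_norm (f₁ - f₀)).tsum_eq
  have hpos : 0 < ‖f₁ - f₀‖ := norm_pos_iff.2 (sub_ne_zero.2 hne.symm)
  set c := ∑' l, |mixDensity p f₁ l - mixDensity p f₀ l| with hc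
  have hc0 : 0 ≤ c := tsum_nonneg fun _ => abs_nonneg _
  -- For `n ≥ 1`, `16 + 16 * c * n ≤ (16 + 16 * c) * n`.
  refine ⟨‖f₁ - f₀‖ ^ 2 / (16 + 16 * c), by positivity, fun n hn => ?_⟩
  refine le_trans (ENNReal.ofReal_le_ofReal ?_)
    ((ofReal_le_minimaxMise_segment p h₀ h₁ n).trans (minimaxMise_mono p n hC))
  rw [hc₀, ← hc, ← div_eq_mul_inv, div_div]
  have hn1 : (1 : ℝ) ≤ n := by exact_mod_cast hn
  gcongr
  linarith

/-- Two distinct point masses span a proper segment in `H₁`, which yields the lower rate over `H₁`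
itself. -/
theorem single_mem_H₁ (k : ℤ) : (lp.single 2 k (1 : ℝ) : H) ∈ H₁ := by
  refine ⟨fun j => ?_, ?_⟩
  · rw [lp.single_apply, Pi.single_apply]
    split_ifs <;> norm_num
  · simpa [lp.single_apply, Pi.single_apply] using hasSum_ite_eq k (1 : ℝ)

theorem single_zero_ne_single_one : (lp.single 2 0 (1 : ℝ) : H) ≠ lp.single 2 1 (1 : ℝ) := by
  intro h
  have := congrArg (fun f : H => f 0) h
  simp [lp.single_apply] at this
end DiscreteDeconvolution

end

open DiscreteDeconvolution in
theorem theorem4 :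
    ∃ K₁ K₂ : ℝ, 0 < K₁ ∧ 0 < K₂ ∧ ∀ p : PMF ℤ, Kp p < ∞ →
      -- the Fourier estimator is a well-defined unbiased estimator with values in `l²(ℤ)`
      (∀ n : ℕ, 0 < n →
        (∀ (x : Fin n → ℤ) (k : ℤ),
          ((fourierEstimator p n x k : ℝ) : ℂ) = fourierCoefficient p x k) ∧
        fourierEstimator p n ∈ estimators n ∧
        ∀ f ∈ H₁, ∀ k : ℤ,
          MeasureTheory.Integrable (fun x => fourierEstimator p n x k) (sampleLaw p f n) ∧
          ∫ x, fourierEstimator p n x k ∂(sampleLaw p f n) = f k) ∧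
      -- its maximal MISE over `H₁` has the exact rate `1 / n`
      (∃ a : ℝ, 0 < a ∧ ∀ n : ℕ, 0 < n →
        ENNReal.ofReal (a / n) ≤ maxMise p (fourierEstimator p n) H₁ ∧
        maxMise p (fourierEstimator p n) H₁ ≤ Kp p / ENNReal.ofReal (2 * Real.pi * n)) ∧
      -- this rate is minimax over every class of densities that contains a proper segment
      (∀ C : Set H, C ⊆ H₁ →
        (∃ f₀ ∈ H₁, ∃ f₁ ∈ H₁, f₀ ≠ f₁ ∧ segment ℝ f₀ f₁ ⊆ C) →
        ∃ a : ℝ, 0 < a ∧ ∀ n : ℕ, 0 < n →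
          ENNReal.ofReal (a / n) ≤ minimaxMise p n C ∧
          minimaxMise p n C ≤ maxMise p (fourierEstimator p n) C ∧
          maxMise p (fourierEstimator p n) C ≤ Kp p / ENNReal.ofReal (2 * Real.pi * n)) ∧
      -- the explicit bounds
      (∀ f₀ ∈ H₁, ∀ f₁ ∈ H₁, ∀ n : ℕ, 0 < n →
        ENNReal.ofReal ((∑' l : ℤ, (f₁ l - f₀ l) ^ 2) *
            (K₁ + K₂ * (∑' l : ℤ, |mixDensity p f₁ l - mixDensity p f₀ l|) * n)⁻¹)
          ≤ minimaxMise p n (segment ℝ f₀ f₁) ∧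
        minimaxMise p n (segment ℝ f₀ f₁) ≤ maxMise p (fourierEstimator p n) H₁ ∧
        maxMise p (fourierEstimator p n) H₁ ≤ Kp p / ENNReal.ofReal (2 * Real.pi * n)) := by
  refine ⟨16, 16, by norm_num, by norm_num, fun p hp => ⟨fun n hn => ⟨coe_fourierEstimator hp,
    fourierEstimator_mem_estimators p n, fun f hf k => ⟨integrable_fourierEstimator hp hf n k,
      integral_fourierEstimator hp hf hn k⟩⟩, ?_, ?_, ?_⟩⟩
  · obtain ⟨a, ha, h⟩ := exists_div_le_minimaxMise p (single_mem_H₁ 0) (single_mem_H₁ 1)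
      single_zero_ne_single_one (convex_H₁.segment_subset (single_mem_H₁ 0) (single_mem_H₁ 1))
    exact ⟨a, ha, fun n hn =>
      ⟨(h n hn).trans (minimaxMise_le_maxMise_fourierEstimator p n H₁),
        maxMise_fourierEstimator_le hp hn subset_rfl⟩⟩
  · rintro C hC ⟨f₀, h₀, f₁, h₁, hne, hseg⟩
    obtain ⟨a, ha, h⟩ := exists_div_le_minimaxMise p h₀ h₁ hne hseg
    exact ⟨a, ha, fun n hn => ⟨h n hn, minimaxMise_le_maxMise_fourierEstimator p n C,
      maxMise_fourierEstimator_le hp hn hC⟩⟩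
  · intro f₀ h₀ f₁ h₁ n hn
    exact ⟨ofReal_le_minimaxMise_segment p h₀ h₁ n,
      (minimaxMise_le_maxMise_fourierEstimator p n _).trans
        (maxMise_mono p _ (convex_H₁.segment_subset h₀ h₁)),
      maxMise_fourierEstimator_le hp hn subset_rfl⟩
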